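/- **Theorem.** Let $n, m \ge 1$ be integers and let $R, \eta, \zeta > 0$. Let $p_1,q_1,\dots,p_m,q_m$ be independent random points of $\mathbb{R}^n$, each with the normal distribution $\mathcal{N}(0,\sigma^2 I)$, where $\sigma^2 = 2R^2/n$. For $x \in \mathbb{R}^n$ let $\mathcal{A}(x) = (\mathcal{A}_1(x),\dots,\mathcal{A}_m(x))$ be the pattern of the comparisons $$\mathcal{A}_i(x) = \operatorname{sign}\left(\|x-q_i\|^2 - \|x-p_i\|^2\right),$$ so that $\mathcal{A}_i(x) = 1$ if $x$ is closer to $p_i$ and $\mathcal{A}_i(x) = -1$ if $x$ is closer to $q_i$; at a tie, $\mathcal{A}_i(x)$ is a fixed number $s \in [-1,1]$, which may be chosen arbitrarily. Let $$d_H(\mathcal{A}(x),\mathcal{A}(y)) = \frac1m \sum_{i=1}^m \frac12 \left|\mathcal{A}_i(x) - \mathcal{A}_i(y)\right|$$ be the normalized Hamming distance, and let $\mathbb{B}_R^n = \{x \in \mathbb{R}^n : \|x\| \le R\}$, where $\|\cdot\|$ is the Euclidean norm. There exist absolute constants $C_1, c_1, C_2, c_2 > 0$ (independent of $n$, $m$,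 $R$, $\eta$, $\zeta$, $s$) such that if $$m \ge \frac{1}{2\zeta^2}\left(2n\log\frac{3\sqrt n}{\zeta} + \log\frac{2}{\eta}\right),$$ then with probability at least $1-\eta$, for all $x, y \in \mathbb{B}_R^n$, $$C_1\frac{\|x-y\|}{R} - c_1\zeta \;\le\; d_H(\mathcal{A}(x),\mathcal{A}(y)) \;\le\; C_2\frac{\|x-y\|}{R} + c_2\zeta.$$ -/

import Mathlib

open MeasureTheory ProbabilityTheory

/-- The sign function with values `1` on positive and `-1` on negative reals; the value at a tie
`t = 0` is the parameter `s`. -/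
noncomputable def signWithTie (s t : ℝ) : ℝ :=
  if 0 < t then 1 else if t < 0 then -1 else s

/-- The outcome of the comparison of `x` with the pair of items `p`, `q`:
`sign (‖x - q‖² - ‖x - p‖²)`, which is `1` if `x` is closer to `p`, `-1` if `x` is closer to `q`,
and `s` if `x` is equidistant from the two. -/
noncomputable def comparison {n : ℕ} (s : ℝ) (p q x : EuclideanSpace ℝ (Fin n)) : ℝ :=
  signWithTie s (‖x - q‖ ^ 2 - ‖x - p‖ ^ 2)

/-- The pattern of the outcomes of the `m` comparisons of `x` with the pairs `p i`, `q i`. -/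
noncomputable def comparisonPattern {n m : ℕ} (s : ℝ) (p q : Fin m → EuclideanSpace ℝ (Fin n))
    (x : EuclideanSpace ℝ (Fin n)) : Fin m → ℝ :=
  fun i => comparison s (p i) (q i) x

/-- The normalized Hamming distance `(1 / m) ∑ᵢ (1 / 2) |aᵢ - bᵢ|` of two patterns. -/
noncomputable def hammingFraction {m : ℕ} (a b : Fin m → ℝ) : ℝ :=
  (1 / (m : ℝ)) * ∑ i, (1 / 2) * |a i - b i|

/-- The random points `p i` and `q i`, for `i < m`, are mutually independent and each of them has
the Gaussian law with mean zero and covariance matrix `v • 1`. -/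
structure IsGaussianPairModel {Ω : Type*} [MeasurableSpace Ω] (μ : Measure Ω) {n m : ℕ} (v : ℝ)
    (p q : Fin m → Ω → EuclideanSpace ℝ (Fin n)) : Prop where
  hasLaw_fst : ∀ i, HasLaw (p i) (multivariateGaussian 0 (v • (1 : Matrix (Fin n) (Fin n) ℝ))) μ
  hasLaw_snd : ∀ i, HasLaw (q i) (multivariateGaussian 0 (v • (1 : Matrix (Fin n) (Fin n) ℝ))) μ
  indep : iIndepFun (Sum.elim p q : Fin m ⊕ Fin m → Ω → EuclideanSpace ℝ (Fin n)) μ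

/-! A comparison distinguishes `x` from `y` when the bisecting hyperplane of its pair separates
them, so for fixed points the Hamming distance is an empirical frequency of independent events. Two
facts suffice: the separation probability is comparable to `‖x - y‖ / R`, and frequencies can be
controlled simultaneously for all points of the ball.

Probability. Put `c = 2R/√n`. By rotation invariance `a = (q - p)/c` and `b = (p + q)/c` are
independent standard Gaussian vectors, and the quantity whose sign is compared is `c² (⟨a, b⟩ - ⟨a,
(2/c) x⟩)`; the points `(2/c) x` fill the ball of radius `√n`. Given `a`, the component of `b` along
`a/‖a‖` is standard normal, and separation means that it falls between the components of the two
rescaled points. Bounding the normal density above, and below on a bounded interval, reduces both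
estimates to moments of the component of a fixed vector along a random direction
(`integral_abs_directionInner_le`, `le_integral_abs_directionInner`,
`integral_abs_directionInner_mul_le`). In the same way a bisector passes within `δ = ζR/√n` of a
given point with probability at most `2ζ`.

Uniformity. A `δ`-net of the ball has at most `(3√n/ζ)^n` points. Unless the bisector passes within
`δ` of a net point, all points of the `δ`-ball around it are compared alike. Hence the Hamming
distance of arbitrary `x`, `y` lies between the frequencies of `separatingPairs` and `touchingPairs`
at nearby net points. Hoeffding's inequality and a union bound over pairs of net points keep these
within `ζ` of their probabilities, and the condition on `m` is exactly what makes the failure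
probability at most `η`. -/

/-! ### Nets of balls -/

/-- A finite `δ`-separated subset of the ball of radius `R` has at most `(3R/δ)^n` elements. -/
lemma card_le_of_separated_of_subset_closedBall {n : ℕ} {R δ : ℝ} (hδ : 0 < δ) (hδR : δ ≤ R)
    (s : Finset (EuclideanSpace ℝ (Fin n))) (hs : ∀ c ∈ s, ‖c‖ ≤ R)
    (h : ∀ c ∈ s, ∀ d ∈ s, c ≠ d → δ ≤ ‖c - d‖) : (s.card : ℝ) ≤ (3 * R / δ) ^ n := by
  have hR : 0 < R := hδ.trans_le hδR
  let μ : Measure (EuclideanSpace ℝ (Fin n)) := volume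
  have D : Set.Pairwise (s : Set (EuclideanSpace ℝ (Fin n)))
      (Function.onFun Disjoint fun c => Metric.ball c (δ / 2)) := by
    rintro c hc d hd hcd
    apply Metric.ball_disjoint_ball
    rw [dist_eq_norm]
    linarith [h c hc d hd hcd]
  -- Volume comparison: the disjoint balls of radius `δ/2` lie in the ball of radius `R + δ/2 ≤
  -- 3R/2`.
  have hsub : (⋃ c ∈ s, Metric.ball c (δ / 2)) ⊆ Metric.ball 0 (3 * R / 2) := by
    refine Set.iUnion₂_subset fun x hx => Metric.ball_subset_ball' ?_
    rw [dist_zero_right]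
    linarith [hs x hx]
  have I : (s.card : ENNReal) * ENNReal.ofReal ((δ / 2) ^ n) * μ (Metric.ball 0 1) ≤
      ENNReal.ofReal ((3 * R / 2) ^ n) * μ (Metric.ball 0 1) := by
    have h1 : μ (⋃ c ∈ s, Metric.ball c (δ / 2)) =
        (s.card : ENNReal) * ENNReal.ofReal ((δ / 2) ^ n) * μ (Metric.ball 0 1) := by
      rw [measure_biUnion_finset D fun c _ => measurableSet_ball]
      simp only [μ.addHaar_ball_of_pos _ (half_pos hδ), finrank_euclideanSpace, Fintype.card_fin,
        Finset.sum_const, nsmul_eq_mul, mul_assoc]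
    rw [← h1]
    refine (measure_mono hsub).trans_eq ?_
    rw [μ.addHaar_ball_of_pos _ (by positivity), finrank_euclideanSpace, Fintype.card_fin]
  have J := (ENNReal.mul_le_mul_iff_left
    (Metric.measure_ball_pos μ _ zero_lt_one).ne' measure_ball_lt_top.ne).1 I
  have K := ENNReal.toReal_le_of_le_ofReal (by positivity) J
  rw [ENNReal.toReal_mul, ENNReal.toReal_natCast, ENNReal.toReal_ofReal (by positivity)] at K
  rw [show 3 * R / δ = (3 * R / 2) / (δ / 2) by field_simp, div_pow, le_div_iff₀ (by positivity)]
  exact K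

/-- The ball of radius `R` has a `δ`-net of at most `(3R/δ)^n` of its points. -/
lemma exists_net_closedBall {n : ℕ} {R δ : ℝ} (hδ : 0 < δ) (hδR : δ ≤ R) :
    ∃ s : Finset (EuclideanSpace ℝ (Fin n)), (∀ c ∈ s, ‖c‖ ≤ R) ∧
      (s.card : ℝ) ≤ (3 * R / δ) ^ n ∧ ∀ x, ‖x‖ ≤ R → ∃ c ∈ s, ‖x - c‖ ≤ δ := by
  classical
  -- A separated set of maximal cardinality is a net, since an uncovered point could be added to it;
  -- the packing bound ensures that a maximum exists.
  let P : ℕ → Prop := fun k => ∃ s : Finset (EuclideanSpace ℝ (Fin n)), s.card = k ∧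
    (∀ c ∈ s, ‖c‖ ≤ R) ∧ ∀ c ∈ s, ∀ d ∈ s, c ≠ d → δ ≤ ‖c - d‖
  have hbd : ∀ k, P k → k ≤ ⌊(3 * R / δ) ^ n⌋₊ := by
    rintro k ⟨s, rfl, hs, hsep⟩
    exact Nat.le_floor (card_le_of_separated_of_subset_closedBall hδ hδR s hs hsep)
  have h0 : P 0 := ⟨∅, by simp⟩
  obtain ⟨s, hcard, hs, hsep⟩ := Nat.findGreatest_spec (P := P) (Nat.zero_le _) h0
  refine ⟨s, hs, card_le_of_separated_of_subset_closedBall hδ hδR s hs hsep, fun x hx => ?_⟩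
  by_contra! hcon
  have hxs : x ∉ s := fun hx' => by
    have := hcon x hx'
    simp at this
    linarith
  have hP : P (s.card + 1) := by
    refine ⟨insert x s, Finset.card_insert_of_notMem hxs, ?_, ?_⟩
    · intro c hc
      rcases Finset.mem_insert.1 hc with rfl | hc
      exacts [hx, hs c hc]
    · intro c hc d hd hcd
      rcases Finset.mem_insert.1 hc with hcx | hcs <;> rcases Finset.mem_insert.1 hd with hdx | hds
      · exact absurd (hcx.trans hdx.symm) hcd
      · exact hcx ▸ (hcon d hds).le
      · rw [norm_sub_rev]; exact hdx ▸ (hcon c hcs).le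
      · exact hsep c hcs d hds hcd
  have hle := Nat.le_findGreatest (hbd _ hP) hP
  exact absurd (hcard ▸ hle) (Nat.not_succ_le_self _)

/-! ### Concentration of empirical frequencies -/

section Frequencies

variable {Ω α : Type*} [MeasurableSpace Ω] [MeasurableSpace α] {μ : Measure Ω}
  [IsProbabilityMeasure μ] {ν : Measure α} {m : ℕ} {W : Fin m → Ω → α}

/-- Hoeffding's inequality: a centred indicator is sub-Gaussian with parameter `(1/2)^2`, so the
exponent is `(mζ)² / (2 · m/4) = 2mζ²`. -/
lemma measure_frequency_ge_le (hm : 1 ≤ m) (hW : ∀ i, HasLaw (W i) ν μ) (hind : iIndepFun W μ)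
    {A : Set α} (hA : MeasurableSet A) {ζ : ℝ} (hζ : 0 ≤ ζ) :
    μ.real {ω | ν.real A + ζ ≤ (1 / (m : ℝ)) * ∑ i, A.indicator (fun _ => (1 : ℝ)) (W i ω)} ≤
      Real.exp (-(2 * m * ζ ^ 2)) := by
  have hm' : (0 : ℝ) < m := by exact_mod_cast hm
  have hmeas : Measurable (A.indicator (fun _ => (1 : ℝ))) := measurable_const.indicator hA
  let X : Fin m → Ω → ℝ := fun i ω => A.indicator (fun _ => (1 : ℝ)) (W i ω)
  have hX : ∀ i, AEMeasurable (X i) μ := fun i => hmeas.comp_aemeasurable (hW i).aemeasurable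
  have hmean : ∀ i, ∫ ω, X i ω ∂μ = ν.real A := by
    intro i
    have := (hW i).integral_comp (f := A.indicator (fun _ => (1 : ℝ)))
      hmeas.aestronglyMeasurable
    rw [integral_indicator_const _ hA] at this
    simpa [X, Function.comp_def] using this
  have hsub : ∀ i ∈ Finset.univ, HasSubgaussianMGF (fun ω => X i ω - ν.real A)
      ((‖(1 : ℝ) - 0‖₊ / 2) ^ 2) μ := by
    intro i _
    rw [← hmean i]
    refine hasSubgaussianMGF_of_mem_Icc (hX i) (ae_of_all _ fun ω => ?_)
    by_cases h : W i ω ∈ A <;> simp [X, h]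
  have hind' : iIndepFun (fun i ω => X i ω - ν.real A) μ :=
    hind.comp (fun _ a => A.indicator (fun _ => (1 : ℝ)) a - ν.real A)
      fun _ => hmeas.sub_const _
  have key := HasSubgaussianMGF.measure_sum_ge_le_of_iIndepFun hind' hsub
    (ε := m * ζ) (by positivity)
  refine (measureReal_mono ?_).trans (key.trans_eq ?_)
  · intro ω hω
    simp only [Set.mem_ofPred_eq, Finset.sum_sub_distrib, Finset.sum_const, Finset.card_univ,
      Fintype.card_fin, nsmul_eq_mul] at hω ⊢
    rw [one_div, inv_mul_eq_div, le_div_iff₀ hm'] at hω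
    simp only [X]
    linarith
  · congr 1
    simp
    field_simp

/-- The lower tail for `A` is the upper tail for its complement. -/
lemma measure_frequency_le_le (hm : 1 ≤ m) (hW : ∀ i, HasLaw (W i) ν μ) (hind : iIndepFun W μ)
    [IsProbabilityMeasure ν]
    {A : Set α} (hA : MeasurableSet A) {ζ : ℝ} (hζ : 0 ≤ ζ) :
    μ.real {ω | (1 / (m : ℝ)) * ∑ i, A.indicator (fun _ => (1 : ℝ)) (W i ω) ≤ ν.real A - ζ} ≤
      Real.exp (-(2 * m * ζ ^ 2)) := by
  have hm' : (0 : ℝ) < m := by exact_mod_cast hm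
  refine (measureReal_mono ?_).trans (measure_frequency_ge_le hm hW hind hA.compl hζ)
  intro ω hω
  have h1 : ∀ a, Aᶜ.indicator (fun _ => (1 : ℝ)) a = 1 - A.indicator (fun _ => (1 : ℝ)) a := by
    intro a
    by_cases h : a ∈ A <;> simp [h]
  simp only [Set.mem_ofPred_eq, h1, Finset.sum_sub_distrib, Finset.sum_const, Finset.card_univ,
    Fintype.card_fin, nsmul_eq_mul, mul_one, mul_sub] at hω ⊢
  rw [probReal_compl_eq_one_sub hA, one_div, inv_mul_cancel₀ hm'.ne', ← one_div]
  linarith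

end Frequencies

/-! ### Independence of the pairs -/

section Pairs

variable {Ω α : Type*} [MeasurableSpace Ω] [MeasurableSpace α] {μ : Measure Ω}
  {ν : Measure α} [IsProbabilityMeasure ν] {m : ℕ} {p q : Fin m → Ω → α}

/-- Independence of all `2m` points is a product law indexed by `Fin m ⊕ Fin m`; regrouping
coordinates preserves product measures and turns it into a product of pair laws. -/
lemma map_pairs_eq_pi (hp : ∀ i, HasLaw (p i) ν μ) (hq : ∀ i, HasLaw (q i) ν μ)
    (h : iIndepFun (Sum.elim p q : Fin m ⊕ Fin m → Ω → α) μ) :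
    μ.map (fun ω i => (p i ω, q i ω)) = Measure.pi fun _ => ν.prod ν := by
  have hm : ∀ j, AEMeasurable ((Sum.elim p q : Fin m ⊕ Fin m → Ω → α) j) μ := by
    rintro (i | i)
    exacts [(hp i).aemeasurable, (hq i).aemeasurable]
  have h1 := h.map_fun_eq_pi_map hm
  have hlaw : (fun j => μ.map ((Sum.elim p q : Fin m ⊕ Fin m → Ω → α) j)) = fun _ => ν := by
    funext j
    rcases j with i | i
    exacts [(hp i).map_eq, (hq i).map_eq]
  rw [hlaw] at h1
  have h2 := measurePreserving_sumPiEquivProdPi (X := fun _ : Fin m ⊕ Fin m => α) (fun _ => ν)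
  have h3 := (measurePreserving_arrowProdEquivProdArrow α α (Fin m) (fun _ => ν)
    (fun _ => ν)).symm
  have h4 := (h3.comp h2).map_eq
  rw [← h1, AEMeasurable.map_map_of_aemeasurable (h3.comp h2).measurable.aemeasurable
    (aemeasurable_pi_lambda _ hm)] at h4
  exact h4

lemma hasLaw_pair (hp : ∀ i, HasLaw (p i) ν μ) (hq : ∀ i, HasLaw (q i) ν μ)
    (h : iIndepFun (Sum.elim p q : Fin m ⊕ Fin m → Ω → α) μ) (i : Fin m) :
    HasLaw (fun ω => (p i ω, q i ω)) (ν.prod ν) μ where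
  aemeasurable := (hp i).aemeasurable.prodMk (hq i).aemeasurable
  map_eq := by
    have h1 := (measurePreserving_eval (fun _ : Fin m => ν.prod ν) i).map_eq
    rw [← map_pairs_eq_pi hp hq h, AEMeasurable.map_map_of_aemeasurable
      (measurable_pi_apply i).aemeasurable (aemeasurable_pi_lambda _ fun i =>
        (hp i).aemeasurable.prodMk (hq i).aemeasurable)] at h1
    exact h1

lemma iIndepFun_pair [IsProbabilityMeasure μ] (hp : ∀ i, HasLaw (p i) ν μ) (hq : ∀ i, HasLaw (q i) ν μ)
    (h : iIndepFun (Sum.elim p q : Fin m ⊕ Fin m → Ω → α) μ) :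
    iIndepFun (fun i ω => (p i ω, q i ω)) μ := by
  rw [iIndepFun_iff_map_fun_eq_pi_map fun i => (hasLaw_pair hp hq h i).aemeasurable,
    map_pairs_eq_pi hp hq h]
  congr 1
  funext i
  exact (hasLaw_pair hp hq h i).map_eq.symm

end Pairs

/-! ### Comparisons near a given point -/

section Comparison

variable {n : ℕ}

/-- The quantity whose sign decides the comparison of `x` with the pair `z`. -/
noncomputable def comparisonGap (z : EuclideanSpace ℝ (Fin n) × EuclideanSpace ℝ (Fin n))
    (x : EuclideanSpace ℝ (Fin n)) : ℝ :=
  ‖x - z.2‖ ^ 2 - ‖x - z.1‖ ^ 2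

/-- The pairs which are strictly compared in opposite ways by `x` and by `y`. -/
def oppositePairs (x y : EuclideanSpace ℝ (Fin n)) :
    Set (EuclideanSpace ℝ (Fin n) × EuclideanSpace ℝ (Fin n)) :=
  {z | comparisonGap z x * comparisonGap z y < 0}

/-- The pairs whose bisecting hyperplane passes within distance `δ` of `x`. -/
def nearPairs (δ : ℝ) (x : EuclideanSpace ℝ (Fin n)) :
    Set (EuclideanSpace ℝ (Fin n) × EuclideanSpace ℝ (Fin n)) :=
  {z | |comparisonGap z x| ≤ 2 * δ * ‖z.1 - z.2‖}

lemma measurable_comparisonGap (x : EuclideanSpace ℝ (Fin n)) :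
    Measurable fun z => comparisonGap z x := by
  unfold comparisonGap
  fun_prop

lemma measurableSet_oppositePairs (x y : EuclideanSpace ℝ (Fin n)) :
    MeasurableSet (oppositePairs x y) :=
  measurableSet_lt ((measurable_comparisonGap x).mul (measurable_comparisonGap y))
    measurable_const

lemma measurableSet_nearPairs (δ : ℝ) (x : EuclideanSpace ℝ (Fin n)) :
    MeasurableSet (nearPairs δ x) :=
  measurableSet_le (measurable_comparisonGap x).abs (by fun_prop)

/-- The quadratic terms in the point cancel, so the gap is affine with gradient of norm `2‖z.1 -
z.2‖`; this is the source of the factor in `nearPairs`. -/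
lemma comparisonGap_sub_comparisonGap (z : EuclideanSpace ℝ (Fin n) × EuclideanSpace ℝ (Fin n))
    (x y : EuclideanSpace ℝ (Fin n)) :
    comparisonGap z x - comparisonGap z y = 2 * inner ℝ (z.1 - z.2) (x - y) := by
  simp only [comparisonGap, norm_sub_sq_real, inner_sub_left, inner_sub_right, real_inner_comm z.1,
    real_inner_comm z.2]
  ring

lemma abs_comparisonGap_sub_le {z : EuclideanSpace ℝ (Fin n) × EuclideanSpace ℝ (Fin n)}
    {x x₀ : EuclideanSpace ℝ (Fin n)} {δ : ℝ} (h : ‖x - x₀‖ ≤ δ) :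
    |comparisonGap z x - comparisonGap z x₀| ≤ 2 * δ * ‖z.1 - z.2‖ := by
  rw [comparisonGap_sub_comparisonGap, abs_mul, abs_of_pos (two_pos : (0 : ℝ) < 2)]
  have := abs_real_inner_le_norm (z.1 - z.2) (x - x₀)
  nlinarith [mul_le_mul_of_nonneg_left h (norm_nonneg (z.1 - z.2))]

/-- Within distance `δ` the gap changes by less than its size at `x₀`, so its sign persists. In
particular there is no tie at `x`, and the value `s` plays no role. -/
lemma comparison_eq_one_of_notMem_nearPairs {s : ℝ}
    {z : EuclideanSpace ℝ (Fin n) × EuclideanSpace ℝ (Fin n)}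
    {x x₀ : EuclideanSpace ℝ (Fin n)} {δ : ℝ} (h : ‖x - x₀‖ ≤ δ) (hz : z ∉ nearPairs δ x₀)
    (hpos : 0 ≤ comparisonGap z x₀) : comparison s z.1 z.2 x = 1 := by
  simp only [nearPairs, Set.mem_ofPred_eq, not_le, abs_of_nonneg hpos] at hz
  have := (abs_le.1 (abs_comparisonGap_sub_le (z := z) h)).1
  have hx : 0 < comparisonGap z x := by linarith
  exact if_pos hx

lemma comparison_eq_neg_one_of_notMem_nearPairs {s : ℝ}
    {z : EuclideanSpace ℝ (Fin n) × EuclideanSpace ℝ (Fin n)}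
    {x x₀ : EuclideanSpace ℝ (Fin n)} {δ : ℝ} (h : ‖x - x₀‖ ≤ δ) (hz : z ∉ nearPairs δ x₀)
    (hneg : comparisonGap z x₀ ≤ 0) : comparison s z.1 z.2 x = -1 := by
  simp only [nearPairs, Set.mem_ofPred_eq, not_le, abs_of_nonpos hneg] at hz
  have := (abs_le.1 (abs_comparisonGap_sub_le (z := z) h)).2
  have hx : comparisonGap z x < 0 := by linarith
  exact (if_neg hx.not_gt).trans (if_pos hx)

lemma abs_comparison_le_one {s : ℝ} (hs : s ∈ Set.Icc (-1 : ℝ) 1)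
    (p q x : EuclideanSpace ℝ (Fin n)) : |comparison s p q x| ≤ 1 := by
  unfold comparison signWithTie
  split_ifs
  · simp
  · simp
  · exact abs_le.2 hs

lemma half_abs_comparison_sub_le_one {s : ℝ} (hs : s ∈ Set.Icc (-1 : ℝ) 1)
    (p q x y : EuclideanSpace ℝ (Fin n)) :
    (1 / 2) * |comparison s p q x - comparison s p q y| ≤ 1 := by
  linarith [abs_sub (comparison s p q x) (comparison s p q y), abs_comparison_le_one hs p q x,
    abs_comparison_le_one hs p q y]

/-- Outside the set, both comparisons inherit the signs of the gaps at `x₀` and `y₀`, and these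
agree. A zero gap at either point is harmless, because the pair would then be near that point. -/
lemma half_abs_comparison_sub_le_indicator {s : ℝ} (hs : s ∈ Set.Icc (-1 : ℝ) 1)
    (z : EuclideanSpace ℝ (Fin n) × EuclideanSpace ℝ (Fin n))
    {x y x₀ y₀ : EuclideanSpace ℝ (Fin n)} {δ : ℝ} (hx : ‖x - x₀‖ ≤ δ) (hy : ‖y - y₀‖ ≤ δ) :
    (1 / 2) * |comparison s z.1 z.2 x - comparison s z.1 z.2 y| ≤
      (oppositePairs x₀ y₀ ∪ (nearPairs δ x₀ ∪ nearPairs δ y₀)).indicator (fun _ => (1 : ℝ)) z := by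
  by_cases h : z ∈ oppositePairs x₀ y₀ ∪ (nearPairs δ x₀ ∪ nearPairs δ y₀)
  · rw [Set.indicator_of_mem h]
    exact half_abs_comparison_sub_le_one hs _ _ _ _
  · rw [Set.indicator_of_notMem h]
    simp only [Set.mem_union, not_or] at h
    obtain ⟨hopp, hnx, hny⟩ := h
    simp only [oppositePairs, Set.mem_ofPred_eq, not_lt, mul_nonneg_iff] at hopp
    rcases hopp with ⟨h1, h2⟩ | ⟨h1, h2⟩
    · rw [comparison_eq_one_of_notMem_nearPairs hx hnx h1,
        comparison_eq_one_of_notMem_nearPairs hy hny h2]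
      simp
    · rw [comparison_eq_neg_one_of_notMem_nearPairs hx hnx h1,
        comparison_eq_neg_one_of_notMem_nearPairs hy hny h2]
      simp

lemma indicator_le_half_abs_comparison_sub {s : ℝ}
    (z : EuclideanSpace ℝ (Fin n) × EuclideanSpace ℝ (Fin n))
    {x y x₀ y₀ : EuclideanSpace ℝ (Fin n)} {δ : ℝ} (hx : ‖x - x₀‖ ≤ δ) (hy : ‖y - y₀‖ ≤ δ) :
    (oppositePairs x₀ y₀ \ (nearPairs δ x₀ ∪ nearPairs δ y₀)).indicator (fun _ => (1 : ℝ)) z ≤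
      (1 / 2) * |comparison s z.1 z.2 x - comparison s z.1 z.2 y| := by
  by_cases h : z ∈ oppositePairs x₀ y₀ \ (nearPairs δ x₀ ∪ nearPairs δ y₀)
  · rw [Set.indicator_of_mem h]
    simp only [Set.mem_sdiff, Set.mem_union, not_or] at h
    obtain ⟨hopp, hnx, hny⟩ := h
    simp only [oppositePairs, Set.mem_ofPred_eq, mul_neg_iff] at hopp
    rcases hopp with ⟨h1, h2⟩ | ⟨h1, h2⟩
    · rw [comparison_eq_one_of_notMem_nearPairs hx hnx h1.le,
        comparison_eq_neg_one_of_notMem_nearPairs hy hny h2.le]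
      norm_num
    · rw [comparison_eq_neg_one_of_notMem_nearPairs hx hnx h1.le,
        comparison_eq_one_of_notMem_nearPairs hy hny h2.le]
      norm_num
  · rw [Set.indicator_of_notMem h]
    positivity

end Comparison

/-! ### Intervals under the standard Gaussian law on the line -/

/-- The standard normal density is at most `1/√(2π) ≤ 1`. -/
lemma gaussianReal_zero_one_real_le_volume_real {s : Set ℝ} (hs : MeasurableSet s)
    (hfin : volume s ≠ ⊤) : (gaussianReal 0 1).real s ≤ volume.real s := by
  refine ENNReal.toReal_mono hfin ?_
  rw [gaussianReal_of_var_ne_zero 0 one_ne_zero, withDensity_apply _ hs]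
  calc ∫⁻ x in s, gaussianPDF 0 1 x ≤ ∫⁻ _ in s, 1 := by
        refine lintegral_mono fun x => ?_
        rw [gaussianPDF, ← ENNReal.ofReal_one]
        refine ENNReal.ofReal_le_ofReal ?_
        have h1 : (√(2 * Real.pi * (1 : NNReal)))⁻¹ ≤ 1 := by
          refine inv_le_one_of_one_le₀ (Real.one_le_sqrt.2 ?_)
          simp only [NNReal.coe_one]
          linarith [Real.pi_gt_three]
        have h2 : Real.exp (-(x - 0) ^ 2 / (2 * (1 : NNReal))) ≤ 1 := by
          rw [Real.exp_le_one_iff]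
          simp only [NNReal.coe_one]
          linarith [sq_nonneg (x - 0)]
        exact mul_le_one₀ h1 (Real.exp_nonneg _) h2
    _ = volume s := by simp

lemma mul_volume_real_le_gaussianReal_zero_one_real {s : Set ℝ} (hs : MeasurableSet s)
    {K : ℝ} (hsK : ∀ x ∈ s, |x| ≤ K) :
    (√(2 * Real.pi))⁻¹ * Real.exp (-K ^ 2 / 2) * volume.real s ≤ (gaussianReal 0 1).real s := by
  have h : ENNReal.ofReal ((√(2 * Real.pi))⁻¹ * Real.exp (-K ^ 2 / 2)) * volume s ≤
      gaussianReal 0 1 s := by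
    rw [gaussianReal_of_var_ne_zero 0 one_ne_zero, withDensity_apply _ hs,
      ← setLIntegral_const]
    refine setLIntegral_mono (measurable_gaussianPDF 0 1) fun x hx => ENNReal.ofReal_le_ofReal ?_
    have hx2 : x ^ 2 ≤ K ^ 2 := sq_le_sq' (abs_le.1 (hsK x hx)).1 (abs_le.1 (hsK x hx)).2
    simp only [gaussianPDFReal, NNReal.coe_one, mul_one, sub_zero]
    gcongr
  have := ENNReal.toReal_mono (measure_ne_top _ _) h
  rwa [ENNReal.toReal_mul, ENNReal.toReal_ofReal (by positivity)] at this

/-- If `|α| + |β| ≤ K`, the interval lies in `[-K, K]`, where the density is at least the prefactor;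
otherwise the left side is nonpositive. The factor `1 - (|α| + |β|)/K` replaces a truncation, so
that the bound can be integrated over random endpoints using moments only. -/
lemma gaussianReal_zero_one_real_Ioo_ge {K : ℝ} (hK : 0 < K) (α β : ℝ) :
    (√(2 * Real.pi))⁻¹ * Real.exp (-K ^ 2 / 2) * (|α - β| * (1 - (|α| + |β|) / K)) ≤
      (gaussianReal 0 1).real (Set.Ioo (min α β) (max α β)) := by
  set c := (√(2 * Real.pi))⁻¹ * Real.exp (-K ^ 2 / 2) with hc
  have hc0 : 0 ≤ c := by positivity
  by_cases h : |α| + |β| ≤ K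
  · have hvol : volume.real (Set.Ioo (min α β) (max α β)) = |α - β| := by
      rw [Real.volume_real_Ioo_of_le min_le_max, max_sub_min_eq_abs']
    have h1 := mul_volume_real_le_gaussianReal_zero_one_real (K := K)
      (measurableSet_Ioo (a := min α β) (b := max α β)) fun x hx => by
        have hα := abs_le.1 (le_refl |α|)
        have hβ := abs_le.1 (le_refl |β|)
        have h1 : -|α| - |β| ≤ min α β := le_min (by linarith [abs_nonneg β])
          (by linarith [abs_nonneg α])
        have h2 : max α β ≤ |α| + |β| := max_le (by linarith [abs_nonneg β])
          (by linarith [abs_nonneg α])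
        exact abs_le.2 ⟨by linarith [hx.1], by linarith [hx.2]⟩
    rw [hvol] at h1
    refine le_trans (mul_le_mul_of_nonneg_left (mul_le_of_le_one_right (abs_nonneg _) ?_) hc0) h1
    have : 0 ≤ (|α| + |β|) / K := by positivity
    linarith
  · refine le_trans ?_ measureReal_nonneg
    refine mul_nonpos_of_nonneg_of_nonpos hc0 (mul_nonpos_of_nonneg_of_nonpos (abs_nonneg _) ?_)
    rw [sub_nonpos, le_div_iff₀ hK]
    linarith

/-- The first absolute moment of the standard Gaussian law on the line. -/
noncomputable def gaussianAbsMoment : ℝ := ∫ t, |t| ∂gaussianReal 0 1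

lemma gaussianAbsMoment_pos : 0 < gaussianAbsMoment := by
  have hint : Integrable (fun t : ℝ => |t|) (gaussianReal 0 1) :=
    (IsGaussian.integrable_id (μ := gaussianReal 0 1)).abs
  refine (integral_pos_iff_support_of_nonneg (fun t => abs_nonneg t) hint).2 ?_
  have := nullSingletonClass_gaussianReal (μ := 0) (v := 1) one_ne_zero
  have hs : Function.support (fun t : ℝ => |t|) = {0}ᶜ := by
    ext t
    simp
  rw [hs, prob_compl_eq_one_sub (measurableSet_singleton 0), measure_singleton]
  simp

/-! ### Directions of a standard Gaussian vector -/

section Direction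

variable {n : ℕ}

local notation "V" => EuclideanSpace ℝ (Fin n)

/-- The inner product of `u` with the direction of `a`. -/
noncomputable def directionInner (u a : V) : ℝ := inner ℝ (‖a‖⁻¹ • a) u

lemma directionInner_eq (u a : V) : directionInner u a = inner ℝ a u / ‖a‖ := by
  rw [directionInner, real_inner_smul_left, inv_mul_eq_div]

lemma directionInner_sub (u w a : V) :
    directionInner (u - w) a = directionInner u a - directionInner w a := by
  simp [directionInner, inner_sub_right]

@[fun_prop]
lemma measurable_directionInner (u : V) : Measurable (directionInner u) := by
  unfold directionInner
  fun_prop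

lemma abs_directionInner_le (u a : V) : |directionInner u a| ≤ ‖u‖ := by
  refine (abs_real_inner_le_norm _ _).trans (mul_le_of_le_one_left (norm_nonneg _) ?_)
  rw [norm_smul, norm_inv, norm_norm]
  exact inv_mul_le_one

lemma map_inner_stdGaussian (u : V) :
    (stdGaussian V).map (fun a => inner ℝ u a) = gaussianReal 0 (‖u‖₊ ^ 2) := by
  have h := IsGaussian.map_eq_gaussianReal (μ := stdGaussian V) (innerSL ℝ u)
  rw [integral_strongDual_stdGaussian, variance_dual_stdGaussian, innerSL_apply_norm] at h
  rw [← norm_toNNReal, ← Real.toNNReal_pow (norm_nonneg u)]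
  exact h

lemma map_inner_stdGaussian_of_norm_eq_one {u : V} (hu : ‖u‖ = 1) :
    (stdGaussian V).map (fun a => inner ℝ u a) = gaussianReal 0 1 := by
  rw [map_inner_stdGaussian, show ‖u‖₊ = 1 from NNReal.eq hu, one_pow]

lemma integral_inner_sq_stdGaussian (u : V) :
    ∫ a, inner ℝ a u ^ 2 ∂stdGaussian V = ‖u‖ ^ 2 := by
  have h := variance_dual_stdGaussian (innerSL ℝ u)
  rw [variance_of_integral_eq_zero (by fun_prop) (integral_strongDual_stdGaussian _),
    innerSL_apply_norm] at h
  simpa [real_inner_comm] using h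

lemma integrable_inner_sq_stdGaussian (u : V) :
    Integrable (fun a => inner ℝ a u ^ 2) (stdGaussian V) := by
  have h : MemLp (fun a : V => inner ℝ u a) 2 (stdGaussian V) :=
    (innerSL ℝ u).comp_memLp' (IsGaussian.memLp_two_id (μ := stdGaussian V))
  simpa [real_inner_comm] using h.integrable_sq

lemma integrable_abs_inner_stdGaussian (u : V) :
    Integrable (fun a => |inner ℝ a u|) (stdGaussian V) := by
  have h : Integrable (fun a : V => inner ℝ u a) (stdGaussian V) :=
    (innerSL ℝ u).integrable_comp (IsGaussian.integrable_id (μ := stdGaussian V))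
  simpa [real_inner_comm] using h.abs

lemma integral_abs_inner_stdGaussian (u : V) :
    ∫ a, |inner ℝ a u| ∂stdGaussian V = gaussianAbsMoment * ‖u‖ := by
  rcases eq_or_ne u 0 with rfl | hu
  · simp
  have hu' : ‖u‖ ≠ 0 := norm_ne_zero_iff.2 hu
  have h1 : ‖(‖u‖⁻¹ • u)‖ = 1 := by rw [norm_smul, norm_inv, norm_norm, inv_mul_cancel₀ hu']
  have h2 : gaussianAbsMoment = ∫ a, |inner ℝ (‖u‖⁻¹ • u) a| ∂stdGaussian V := by
    rw [gaussianAbsMoment, ← map_inner_stdGaussian_of_norm_eq_one h1,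
      integral_map (by fun_prop) (by fun_prop)]
  rw [h2, ← integral_mul_const]
  refine integral_congr_ae (ae_of_all _ fun a => ?_)
  simp only [real_inner_smul_left, abs_mul, abs_inv, abs_norm, real_inner_comm a u]
  field_simp

lemma integrable_norm_sq_stdGaussian : Integrable (fun a : V => ‖a‖ ^ 2) (stdGaussian V) :=
  (IsGaussian.memLp_two_id (μ := stdGaussian V)).integrable_norm_pow two_ne_zero

lemma integral_norm_sq_stdGaussian : ∫ a : V, ‖a‖ ^ 2 ∂stdGaussian V = n := by
  have h : ∀ a : V, ‖a‖ ^ 2 = ∑ i, inner ℝ a (EuclideanSpace.basisFun (Fin n) ℝ i) ^ 2 := by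
    intro a
    rw [EuclideanSpace.real_norm_sq_eq]
    simp [EuclideanSpace.inner_single_right]
  simp_rw [h]
  rw [integral_finsetSum _ fun i _ => integrable_inner_sq_stdGaussian _]
  simp [integral_inner_sq_stdGaussian]

lemma ae_ne_zero_stdGaussian (hn : 1 ≤ n) : ∀ᵐ a ∂stdGaussian V, a ≠ 0 := by
  have := nullSingletonClass_gaussianReal (μ := 0) (v := 1) one_ne_zero
  let e : V := EuclideanSpace.basisFun (Fin n) ℝ ⟨0, hn⟩
  have he : ‖e‖ = 1 := by simp [e]
  have h0 : gaussianReal 0 1 {0} = 0 := measure_singleton 0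
  rw [← map_inner_stdGaussian_of_norm_eq_one he, Measure.map_apply (by fun_prop)
    (measurableSet_singleton 0)] at h0
  refine measure_mono_null (fun a ha => ?_) h0
  have ha0 : a = 0 := by simpa using ha
  simp [ha0]

lemma integrable_directionInner_sq (u : V) :
    Integrable (fun a => directionInner u a ^ 2) (stdGaussian V) := by
  refine Integrable.of_bound (by fun_prop) (‖u‖ ^ 2) (ae_of_all _ fun a => ?_)
  rw [norm_pow, Real.norm_eq_abs]
  exact pow_le_pow_left₀ (abs_nonneg _) (abs_directionInner_le u a) 2

lemma integrable_abs_directionInner (u : V) :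
    Integrable (fun a => |directionInner u a|) (stdGaussian V) := by
  refine Integrable.of_bound (by fun_prop) ‖u‖ (ae_of_all _ fun a => ?_)
  rw [Real.norm_eq_abs, abs_abs]
  exact abs_directionInner_le u a

lemma integrable_abs_directionInner_mul (u w : V) :
    Integrable (fun a => |directionInner u a| * |directionInner w a|) (stdGaussian V) := by
  refine Integrable.of_bound (by fun_prop) (‖u‖ * ‖w‖) (ae_of_all _ fun a => ?_)
  rw [norm_mul, Real.norm_eq_abs, Real.norm_eq_abs, abs_abs, abs_abs]
  exact mul_le_mul (abs_directionInner_le u a) (abs_directionInner_le w a) (abs_nonneg _)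
    (norm_nonneg _)

/-- The reflection in the hyperplane orthogonal to `u - w` carries `u` to `w` and preserves the
standard Gaussian law. -/
lemma integral_directionInner_sq_eq_of_norm_eq {u w : V} (h : ‖u‖ = ‖w‖) :
    ∫ a, directionInner u a ^ 2 ∂stdGaussian V = ∫ a, directionInner w a ^ 2 ∂stdGaussian V := by
  let ρ : V ≃ₗᵢ[ℝ] V := (ℝ ∙ (u - w))ᗮ.reflection
  have hρ : ρ u = w := Submodule.reflection_sub h
  have hmap : (stdGaussian V).map ρ = stdGaussian V := stdGaussian_map ρ
  conv_rhs => rw [← hmap]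
  rw [integral_map (by fun_prop) (by fun_prop)]
  refine integral_congr_ae (ae_of_all _ fun a => ?_)
  simp only [directionInner_eq, ← hρ, LinearIsometryEquiv.inner_map_map,
    LinearIsometryEquiv.norm_map]

/-- The squared components of a unit direction along an orthonormal basis add up to 1 and have equal
means by symmetry, so each mean is `1/n`; homogeneity gives the rest. -/
lemma integral_directionInner_sq (hn : 1 ≤ n) (u : V) :
    ∫ a, directionInner u a ^ 2 ∂stdGaussian V = ‖u‖ ^ 2 / n := by
  have hn' : (n : ℝ) ≠ 0 := by positivity
  let e : Fin n → V := EuclideanSpace.basisFun (Fin n) ℝ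
  have he : ∀ i, ‖e i‖ = 1 := fun i => by simp [e]
  have hsum : ∑ i, ∫ a, directionInner (e i) a ^ 2 ∂stdGaussian V = 1 := by
    rw [← integral_finsetSum _ fun i _ => integrable_directionInner_sq _]
    have : ∀ᵐ a ∂stdGaussian V, ∑ i, directionInner (e i) a ^ 2 = 1 := by
      filter_upwards [ae_ne_zero_stdGaussian hn] with a ha
      have ha' : ‖a‖ ^ 2 ≠ 0 := pow_ne_zero 2 (norm_ne_zero_iff.2 ha)
      simp only [directionInner_eq, div_pow, ← Finset.sum_div]
      rw [div_eq_one_iff_eq ha', EuclideanSpace.real_norm_sq_eq]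
      simp [e, EuclideanSpace.inner_single_right]
    rw [integral_congr_ae this]
    simp
  have hconst : ∀ i, ∫ a, directionInner (e i) a ^ 2 ∂stdGaussian V =
      ∫ a, directionInner (e ⟨0, hn⟩) a ^ 2 ∂stdGaussian V := fun i =>
    integral_directionInner_sq_eq_of_norm_eq ((he i).trans (he _).symm)
  simp_rw [hconst] at hsum
  rw [Finset.sum_const, Finset.card_univ, Fintype.card_fin, nsmul_eq_mul] at hsum
  have hu : ‖u‖ = ‖(‖u‖ • e ⟨0, hn⟩)‖ := by rw [norm_smul, he, norm_norm, mul_one]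
  rw [integral_directionInner_sq_eq_of_norm_eq hu]
  have : ∀ a, directionInner (‖u‖ • e ⟨0, hn⟩) a ^ 2 =
      ‖u‖ ^ 2 * directionInner (e ⟨0, hn⟩) a ^ 2 := fun a => by
    rw [directionInner, real_inner_smul_right, mul_pow, directionInner]
  simp_rw [this]
  rw [integral_const_mul, eq_div_iff hn']
  linear_combination ‖u‖ ^ 2 * hsum

/-- Young's inequality with a weight. This bounds the error produced by the factor `1 - (|α| +
|β|)/K` in the lower estimate. -/
lemma integral_abs_directionInner_mul_le (hn : 1 ≤ n) {u w : V} (hw : ‖w‖ ≤ √n) :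
    ∫ a, |directionInner u a| * |directionInner w a| ∂stdGaussian V ≤ ‖u‖ / √n := by
  have hn0 : (0 : ℝ) < n := by exact_mod_cast hn
  have hs : 0 < √(n : ℝ) := Real.sqrt_pos.2 hn0
  rcases eq_or_ne u 0 with rfl | hu
  · simp [directionInner]
  have hu' : 0 < ‖u‖ := norm_pos_iff.2 hu
  -- This weight makes the first term of the Young bound equal to `l/2`, and the second at most
  -- `l/2`.
  set l := ‖u‖ / √n with hl
  have hl0 : 0 < l := by positivity
  have hi := ((integrable_directionInner_sq u).div_const (2 * l)).add
    ((integrable_directionInner_sq w).const_mul (l / 2))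
  calc ∫ a, |directionInner u a| * |directionInner w a| ∂stdGaussian V
      ≤ ∫ a, (directionInner u a ^ 2 / (2 * l) + l / 2 * directionInner w a ^ 2) ∂stdGaussian V := by
        refine integral_mono (integrable_abs_directionInner_mul u w) hi fun a => ?_
        have : directionInner u a ^ 2 / (2 * l) + l / 2 * directionInner w a ^ 2 -
            |directionInner u a| * |directionInner w a| =
            (|directionInner u a| - l * |directionInner w a|) ^ 2 / (2 * l) := by
          rw [← sq_abs (directionInner u a), ← sq_abs (directionInner w a)]
          field_simp
          ring
        have h2 : 0 ≤ (|directionInner u a| - l * |directionInner w a|) ^ 2 / (2 * l) := by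
          positivity
        simp only
        linarith
    _ = ‖u‖ ^ 2 / n / (2 * l) + l / 2 * (‖w‖ ^ 2 / n) := by
        rw [integral_add ((integrable_directionInner_sq u).div_const _)
          ((integrable_directionInner_sq w).const_mul _), integral_div, integral_const_mul,
          integral_directionInner_sq hn, integral_directionInner_sq hn]
    _ ≤ l := by
        have h1 : ‖u‖ ^ 2 / n / (2 * l) = l / 2 := by
          rw [hl]
          field_simp
          rw [Real.sq_sqrt hn0.le]
        have h2 : ‖w‖ ^ 2 / n ≤ 1 := by
          rw [div_le_one hn0, ← Real.sq_sqrt hn0.le]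
          exact pow_le_pow_left₀ (norm_nonneg _) hw 2
        nlinarith

lemma integral_abs_directionInner_le (hn : 1 ≤ n) (u : V) :
    ∫ a, |directionInner u a| ∂stdGaussian V ≤ ‖u‖ / √n := by
  have hn0 : (0 : ℝ) < n := by exact_mod_cast hn
  have h := integral_directionInner_sq hn u
  -- Nonnegativity of the variance gives `(E|X|)² ≤ E X²`.
  have hvar := variance_nonneg (fun a => |directionInner u a|) (stdGaussian V)
  rw [variance_eq_sub (MemLp.of_bound (by fun_prop) ‖u‖ (ae_of_all _ fun a => by
    simpa using abs_directionInner_le u a))] at hvar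
  simp only [Pi.pow_apply, sq_abs, h] at hvar
  refine abs_le_of_sq_le_sq' ?_ (by positivity) |>.2
  rw [div_pow, Real.sq_sqrt hn0.le]
  linarith

lemma integral_abs_inner_mul_norm_le (hn : 1 ≤ n) (u : V) :
    Integrable (fun a => |inner ℝ a u| * ‖a‖) (stdGaussian V) ∧
    ∫ a, |inner ℝ a u| * ‖a‖ ∂stdGaussian V ≤ ‖u‖ * √n := by
  have hn0 : (0 : ℝ) < n := by exact_mod_cast hn
  have hs : 0 < √(n : ℝ) := Real.sqrt_pos.2 hn0
  rcases eq_or_ne u 0 with rfl | hu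
  · simp
  have hu' : 0 < ‖u‖ := norm_pos_iff.2 hu
  set l := ‖u‖ / √n with hl
  have hl0 : 0 < l := by positivity
  have hi := ((integrable_inner_sq_stdGaussian u).div_const (2 * l)).add
    ((integrable_norm_sq_stdGaussian (n := n)).const_mul (l / 2))
  have hle : ∀ a : V, |inner ℝ a u| * ‖a‖ ≤ inner ℝ a u ^ 2 / (2 * l) + l / 2 * ‖a‖ ^ 2 := by
    intro a
    have h1 : inner ℝ a u ^ 2 / (2 * l) + l / 2 * ‖a‖ ^ 2 - |inner ℝ a u| * ‖a‖ =
        (|inner ℝ a u| - l * ‖a‖) ^ 2 / (2 * l) := by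
      rw [← sq_abs (inner ℝ a u)]
      field_simp
      ring
    have h2 : 0 ≤ (|inner ℝ a u| - l * ‖a‖) ^ 2 / (2 * l) := by positivity
    linarith
  have hint : Integrable (fun a => |inner ℝ a u| * ‖a‖) (stdGaussian V) := by
    refine hi.mono' (by fun_prop) (ae_of_all _ fun a => ?_)
    rw [Real.norm_of_nonneg (by positivity)]
    exact hle a
  refine ⟨hint, (integral_mono hint hi hle).trans_eq ?_⟩
  rw [integral_add' ((integrable_inner_sq_stdGaussian u).div_const _)
    (integrable_norm_sq_stdGaussian.const_mul _), integral_div, integral_const_mul,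
    integral_inner_sq_stdGaussian, integral_norm_sq_stdGaussian, hl]
  field_simp
  rw [Real.sq_sqrt hn0.le]
  ring

/-- The convex function `t ↦ 1/t` lies above its tangent at `r`, that is `1/t ≥ 2/r - t/r²`. With `t
= ‖a‖` this removes the norm from the denominator and leaves two computable moments; `r = √n/κ`
maximizes the resulting bound. -/
lemma le_integral_abs_directionInner (hn : 1 ≤ n) (u : V) :
    gaussianAbsMoment ^ 2 * (‖u‖ / √n) ≤ ∫ a, |directionInner u a| ∂stdGaussian V := by
  have hn0 : (0 : ℝ) < n := by exact_mod_cast hn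
  have hs : 0 < √(n : ℝ) := Real.sqrt_pos.2 hn0
  have hκ := gaussianAbsMoment_pos
  set κ := gaussianAbsMoment with hκdef
  set r := √n / κ with hr
  have hr0 : 0 < r := by positivity
  obtain ⟨hint, hle⟩ := integral_abs_inner_mul_norm_le hn u
  have hi := ((integrable_abs_inner_stdGaussian u).const_mul (2 / r)).sub
    (hint.const_mul (1 / r ^ 2))
  have hpt : ∀ a : V, 2 / r * |inner ℝ a u| - 1 / r ^ 2 * (|inner ℝ a u| * ‖a‖) ≤
      |directionInner u a| := by
    intro a
    rcases eq_or_ne a 0 with rfl | ha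
    · simp
    have ha' : 0 < ‖a‖ := norm_pos_iff.2 ha
    rw [directionInner_eq, abs_div, abs_norm]
    have h1 : |inner ℝ a u| / ‖a‖ -
        (2 / r * |inner ℝ a u| - 1 / r ^ 2 * (|inner ℝ a u| * ‖a‖)) =
        |inner ℝ a u| * (r - ‖a‖) ^ 2 / (r ^ 2 * ‖a‖) := by
      field_simp
      ring
    have h2 : 0 ≤ |inner ℝ a u| * (r - ‖a‖) ^ 2 / (r ^ 2 * ‖a‖) := by positivity
    linarith
  refine le_trans ?_ (integral_mono hi (integrable_abs_directionInner u) hpt)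
  rw [integral_sub' ((integrable_abs_inner_stdGaussian u).const_mul _) (hint.const_mul _),
    integral_const_mul, integral_const_mul, integral_abs_inner_stdGaussian]
  have h3 : 1 / r ^ 2 * ∫ a, |inner ℝ a u| * ‖a‖ ∂stdGaussian V ≤ κ ^ 2 * (‖u‖ / √n) := by
    refine (mul_le_mul_of_nonneg_left hle (by positivity)).trans_eq ?_
    rw [hr]
    field_simp
  have h4 : 2 / r * (κ * ‖u‖) = 2 * (κ ^ 2 * (‖u‖ / √n)) := by
    rw [hr]
    field_simp
  rw [← hκdef, h4]
  linarith

end Direction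

/-! ### Separation by a Gaussian pair in standard coordinates -/

lemma measureReal_prod_eq_integral {α β : Type*} [MeasurableSpace α] [MeasurableSpace β]
    {μ : Measure α} {ν : Measure β} [IsProbabilityMeasure μ] [IsProbabilityMeasure ν]
    {s : Set (α × β)} (hs : MeasurableSet s) :
    (μ.prod ν).real s = ∫ a, ν.real (Prod.mk a ⁻¹' s) ∂μ := by
  simp only [measureReal_def]
  rw [Measure.prod_apply hs, integral_toReal (measurable_measure_prodMk_left hs).aemeasurable
    (ae_of_all _ fun a => measure_lt_top _ _)]

lemma integrable_measureReal_prodMk {α β : Type*} [MeasurableSpace α] [MeasurableSpace β]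
    {μ : Measure α} {ν : Measure β} [IsProbabilityMeasure μ] [IsProbabilityMeasure ν]
    {s : Set (α × β)} (hs : MeasurableSet s) :
    Integrable (fun a => ν.real (Prod.mk a ⁻¹' s)) μ := by
  refine Integrable.of_bound
    (measurable_measure_prodMk_left hs).ennreal_toReal.aestronglyMeasurable 1
    (ae_of_all _ fun a => ?_)
  rw [Real.norm_of_nonneg measureReal_nonneg]
  exact measureReal_le_one

lemma mul_neg_iff_neg_right_of_pos {a b : ℝ} (ha : 0 < a) : a * b < 0 ↔ b < 0 := by
  simpa using mul_lt_mul_iff_right₀ (b := b) (c := 0) ha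

section Standard

variable {n : ℕ}

local notation "V" => EuclideanSpace ℝ (Fin n)

/-- The signed gap of `x` for the hyperplane through `w.2` normal to `w.1`. -/
noncomputable def linearGap (x : V) (w : V × V) : ℝ := inner ℝ w.1 w.2 - inner ℝ w.1 x

@[fun_prop]
lemma measurable_linearGap (x : V) : Measurable (linearGap x) := by
  unfold linearGap
  fun_prop

lemma linearGap_eq {a : V} (ha : a ≠ 0) (b x : V) :
    linearGap x (a, b) = ‖a‖ * (inner ℝ (‖a‖⁻¹ • a) b - directionInner x a) := by
  have ha' : ‖a‖ ≠ 0 := norm_ne_zero_iff.2 ha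
  rw [directionInner_eq, linearGap, real_inner_smul_left]
  field_simp

lemma stdGaussian_real_preimage_direction {a : V} (ha : a ≠ 0) {s : Set ℝ} (hs : MeasurableSet s) :
    (stdGaussian V).real ((fun b => inner ℝ (‖a‖⁻¹ • a) b) ⁻¹' s) = (gaussianReal 0 1).real s := by
  have ha' : ‖a‖ ≠ 0 := norm_ne_zero_iff.2 ha
  have h1 : ‖(‖a‖⁻¹ • a)‖ = 1 := by rw [norm_smul, norm_inv, norm_norm, inv_mul_cancel₀ ha']
  rw [← map_inner_stdGaussian_of_norm_eq_one h1, map_measureReal_apply (by fun_prop) hs]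

lemma measurableSet_abs_linearGap_le (x : V) (ζ : ℝ) :
    MeasurableSet {w : V × V | |linearGap x w| ≤ ζ * ‖w.1‖} :=
  measurableSet_le (measurable_linearGap x).abs (by fun_prop)

lemma stdGaussian_prod_abs_linearGap_le (hn : 1 ≤ n) (x : V) {ζ : ℝ} (hζ : 0 ≤ ζ) :
    ((stdGaussian V).prod (stdGaussian V)).real {w : V × V | |linearGap x w| ≤ ζ * ‖w.1‖} ≤
      2 * ζ := by
  have hms := measurableSet_abs_linearGap_le x ζ
  rw [measureReal_prod_eq_integral hms]
  calc _ ≤ ∫ _, 2 * ζ ∂stdGaussian V := by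
        refine integral_mono_ae (integrable_measureReal_prodMk hms) (integrable_const _) ?_
        filter_upwards [ae_ne_zero_stdGaussian hn] with a ha
        have ha' : 0 < ‖a‖ := norm_pos_iff.2 ha
        have hset : Prod.mk a ⁻¹' {w : V × V | |linearGap x w| ≤ ζ * ‖w.1‖} =
            (fun b => inner ℝ (‖a‖⁻¹ • a) b) ⁻¹'
              Set.Icc (directionInner x a - ζ) (directionInner x a + ζ) := by
          ext b
          simp only [Set.mem_preimage, Set.mem_ofPred_eq, linearGap_eq ha, abs_mul, abs_norm,
            Set.mem_Icc]
          rw [mul_comm ζ, mul_le_mul_iff_right₀ ha', abs_le]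
          constructor <;> rintro ⟨h1, h2⟩ <;> constructor <;> linarith
        rw [hset, stdGaussian_real_preimage_direction ha measurableSet_Icc]
        refine (gaussianReal_zero_one_real_le_volume_real measurableSet_Icc (by simp)).trans ?_
        rw [Real.volume_real_Icc_of_le (by linarith)]
        linarith
    _ = 2 * ζ := by simp

lemma measurableSet_linearGap_mul_neg (x y : V) :
    MeasurableSet {w : V × V | linearGap x w * linearGap y w < 0} :=
  measurableSet_lt (by fun_prop) measurable_const

/-- After division by `‖a‖²`, opposite signs mean that the normal variable `⟨a/‖a‖, b⟩` lies
strictly between the components of `x` and `y` along `a`. -/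
lemma stdGaussian_real_linearGap_mul_neg {a : V} (ha : a ≠ 0) (x y : V) :
    (stdGaussian V).real (Prod.mk a ⁻¹' {w : V × V | linearGap x w * linearGap y w < 0}) =
      (gaussianReal 0 1).real (Set.Ioo (min (directionInner x a) (directionInner y a))
        (max (directionInner x a) (directionInner y a))) := by
  rw [← stdGaussian_real_preimage_direction ha measurableSet_Ioo]
  congr 1
  ext b
  have ha' : 0 < ‖a‖ := norm_pos_iff.2 ha
  simp only [Set.mem_preimage, Set.mem_ofPred_eq, linearGap_eq ha, Set.mem_Ioo, min_lt_iff,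
    lt_max_iff]
  rw [mul_mul_mul_comm, mul_neg_iff_neg_right_of_pos (mul_pos ha' ha'), mul_neg_iff]
  simp only [sub_pos, sub_neg]
  constructor
  · rintro (⟨h1, h2⟩ | ⟨h1, h2⟩)
    exacts [⟨Or.inl h1, Or.inr h2⟩, ⟨Or.inr h2, Or.inl h1⟩]
  · rintro ⟨h1 | h1, h2 | h2⟩
    exacts [absurd h1 h2.not_gt, Or.inl ⟨h1, h2⟩, Or.inr ⟨h2, h1⟩, absurd h1 h2.not_gt]

lemma stdGaussian_prod_linearGap_mul_neg_le (hn : 1 ≤ n) (x y : V) :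
    ((stdGaussian V).prod (stdGaussian V)).real
      {w : V × V | linearGap x w * linearGap y w < 0} ≤ ‖x - y‖ / √n := by
  have hms := measurableSet_linearGap_mul_neg x y
  rw [measureReal_prod_eq_integral hms]
  refine le_trans ?_ (integral_abs_directionInner_le hn (x - y))
  refine integral_mono_ae (integrable_measureReal_prodMk hms)
    (integrable_abs_directionInner _) ?_
  filter_upwards [ae_ne_zero_stdGaussian hn] with a ha
  rw [stdGaussian_real_linearGap_mul_neg ha]
  refine (gaussianReal_zero_one_real_le_volume_real measurableSet_Ioo (by simp)).trans ?_
  rw [Real.volume_real_Ioo_of_le min_le_max, max_sub_min_eq_abs', directionInner_sub]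

/-- The constant in the lower bound for the probability of separation. -/
noncomputable def separationConstant : ℝ :=
  (√(2 * Real.pi))⁻¹ * Real.exp (-(4 / gaussianAbsMoment ^ 2) ^ 2 / 2) *
    (gaussianAbsMoment ^ 2 / 2)

lemma separationConstant_pos : 0 < separationConstant := by
  have := gaussianAbsMoment_pos
  unfold separationConstant
  positivity

lemma le_stdGaussian_prod_linearGap_mul_neg (hn : 1 ≤ n) {x y : V} (hx : ‖x‖ ≤ √n)
    (hy : ‖y‖ ≤ √n) :
    separationConstant * (‖x - y‖ / √n) ≤
      ((stdGaussian V).prod (stdGaussian V)).real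
        {w : V × V | linearGap x w * linearGap y w < 0} := by
  have hκ := gaussianAbsMoment_pos
  have hms := measurableSet_linearGap_mul_neg x y
  rw [measureReal_prod_eq_integral hms]
  set κ := gaussianAbsMoment with hκdef
  -- The error terms total at most `2/K` times `‖x - y‖/√n`; this `K` makes that half of the main
  -- term `κ² ‖x - y‖/√n`.
  set K := 4 / κ ^ 2 with hK
  have hK0 : 0 < K := by positivity
  set c := (√(2 * Real.pi))⁻¹ * Real.exp (-K ^ 2 / 2) with hc
  have hc0 : 0 < c := by positivity
  have hi0 := integrable_abs_directionInner (x - y)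
  have hi1 := integrable_abs_directionInner_mul (x - y) x
  have hi2 := integrable_abs_directionInner_mul (x - y) y
  have hi12 : Integrable (fun a => (|directionInner (x - y) a| * |directionInner x a| +
      |directionInner (x - y) a| * |directionInner y a|) / K) (stdGaussian V) :=
    (hi1.add hi2).div_const K
  have hi := (hi0.sub hi12).const_mul c
  have hmono : ∫ a, c * (|directionInner (x - y) a| -
      (|directionInner (x - y) a| * |directionInner x a| +
        |directionInner (x - y) a| * |directionInner y a|) / K) ∂stdGaussian V ≤
      ∫ a, (stdGaussian V).real
        (Prod.mk a ⁻¹' {w : V × V | linearGap x w * linearGap y w < 0}) ∂stdGaussian V := by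
    refine integral_mono_ae hi (integrable_measureReal_prodMk hms) ?_
    filter_upwards [ae_ne_zero_stdGaussian hn] with a ha
    rw [stdGaussian_real_linearGap_mul_neg ha]
    refine le_of_eq_of_le ?_ (gaussianReal_zero_one_real_Ioo_ge hK0 _ _)
    rw [← directionInner_sub]
    ring
  refine le_trans ?_ hmono
  rw [integral_const_mul, integral_sub hi0 hi12, integral_div,
    integral_add hi1 hi2]
  have h0 := le_integral_abs_directionInner hn (x - y)
  have h1 := integral_abs_directionInner_mul_le hn (u := x - y) hx
  have h2 := integral_abs_directionInner_mul_le hn (u := x - y) hy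
  rw [separationConstant, ← hκdef, ← hK, ← hc, mul_assoc]
  refine mul_le_mul_of_nonneg_left ?_ hc0.le
  have h3 : (∫ a, |directionInner (x - y) a| * |directionInner x a| ∂stdGaussian V +
      ∫ a, |directionInner (x - y) a| * |directionInner y a| ∂stdGaussian V) / K ≤
      (‖x - y‖ / √n + ‖x - y‖ / √n) / K := by gcongr
  have h4 : (‖x - y‖ / √n + ‖x - y‖ / √n) / K = κ ^ 2 / 2 * (‖x - y‖ / √n) := by
    rw [hK]
    field_simp
    ring
  linarith

end Standard

/-! ### Change of coordinates for a pair of Gaussian points -/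

section Coordinates

variable {n : ℕ}

local notation "V" => EuclideanSpace ℝ (Fin n)

lemma multivariateGaussian_zero_smul_one {v : ℝ} (hv : 0 ≤ v) :
    multivariateGaussian 0 (v • (1 : Matrix (Fin n) (Fin n) ℝ)) =
      (stdGaussian V).map (fun x => √v • x) := by
  have hpsd : (v • (1 : Matrix (Fin n) (Fin n) ℝ)).PosSemidef := Matrix.PosSemidef.one.smul hv
  refine Measure.ext_of_charFun (funext fun t => ?_)
  rw [charFun_multivariateGaussian hpsd, charFun_map_smul, charFun_stdGaussian]
  congr 1
  have h : t.ofLp ⬝ᵥ (v • (1 : Matrix (Fin n) (Fin n) ℝ)).mulVec t.ofLp = v * ‖t‖ ^ 2 := by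
    rw [Matrix.smul_mulVec, Matrix.one_mulVec, dotProduct_smul, EuclideanSpace.real_norm_sq_eq]
    simp [dotProduct, pow_two]
  rw [h, norm_smul, Real.norm_of_nonneg (Real.sqrt_nonneg v), ← Complex.ofReal_pow, mul_pow,
    Real.sq_sqrt hv]
  simp
  ring

/-- The rescaled difference and sum of the two points of a pair. -/
noncomputable def pairCoordinates (c : ℝ) (z : V × V) : V × V :=
  (c⁻¹ • (z.2 - z.1), c⁻¹ • (z.1 + z.2))

lemma measurable_pairCoordinates (c : ℝ) : Measurable (pairCoordinates (n := n) c) := by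
  unfold pairCoordinates
  fun_prop

/-- On points scaled by `√v`, the coordinates are the rotation by `π/4` followed by a swap, and both
preserve the product of two standard Gaussian laws. -/
lemma map_pairCoordinates {v : ℝ} (hv : 0 < v) :
    ((multivariateGaussian 0 (v • (1 : Matrix (Fin n) (Fin n) ℝ))).prod
      (multivariateGaussian 0 (v • (1 : Matrix (Fin n) (Fin n) ℝ)))).map
        (pairCoordinates √(2 * v)) = (stdGaussian V).prod (stdGaussian V) := by
  have hrot := IsGaussian.map_rotation_eq_self_of_forall_strongDual_eq_zero
    (μ := stdGaussian V) (fun L => integral_strongDual_stdGaussian L) (Real.pi / 4)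
  have hs : √v ≠ 0 := (Real.sqrt_pos.2 hv).ne'
  have hf : Measurable fun x : V => √v • x := by fun_prop
  rw [multivariateGaussian_zero_smul_one hv.le, Measure.map_prod_map _ _ hf hf,
    Measure.map_map (measurable_pairCoordinates _) (hf.prodMap hf)]
  have hcomp : pairCoordinates √(2 * v) ∘ Prod.map (fun x : V => √v • x) (fun x : V => √v • x) =
      Prod.swap ∘ ContinuousLinearMap.rotation (Real.pi / 4) := by
    funext z
    have h2 : (√2)⁻¹ = √2 / 2 := by
      rw [inv_eq_iff_eq_inv, inv_div, eq_div_iff (by positivity), Real.mul_self_sqrt (by norm_num)]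
    have h1 : (√(2 * v))⁻¹ * √v = √2 / 2 := by
      rw [Real.sqrt_mul zero_le_two, mul_inv, mul_assoc, inv_mul_cancel₀ hs, mul_one, h2]
    simp only [Function.comp_apply, pairCoordinates, Prod.map_fst, Prod.map_snd,
      ContinuousLinearMap.rotation_apply, Prod.swap_prod_mk, Real.cos_pi_div_four,
      Real.sin_pi_div_four, ← smul_sub, ← smul_add, smul_smul, h1]
    congr 1
    rw [smul_sub, neg_smul]
    abel
  rw [hcomp, ← Measure.map_map measurable_swap (by fun_prop), hrot, Measure.prod_swap]

lemma comparisonGap_eq_linearGap {c : ℝ} (hc : c ≠ 0) (z : V × V) (x : V) :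
    comparisonGap z x = c ^ 2 * linearGap ((2 / c) • x) (pairCoordinates c z) := by
  simp only [comparisonGap, linearGap, pairCoordinates, norm_sub_sq_real, inner_smul_left,
    inner_smul_right, inner_sub_left, inner_add_right, real_inner_self_eq_norm_sq,
    real_inner_comm z.2 z.1, real_inner_comm z.1 x, real_inner_comm z.2 x, conj_trivial]
  field_simp
  ring

lemma oppositePairs_eq_preimage {c : ℝ} (hc : 0 < c) (x y : V) :
    oppositePairs x y = pairCoordinates c ⁻¹'
      {w | linearGap ((2 / c) • x) w * linearGap ((2 / c) • y) w < 0} := by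
  ext z
  simp only [oppositePairs, Set.mem_preimage, Set.mem_ofPred_eq,
    comparisonGap_eq_linearGap hc.ne']
  rw [mul_mul_mul_comm, mul_neg_iff_neg_right_of_pos (by positivity)]

lemma nearPairs_eq_preimage {c : ℝ} (hc : 0 < c) (δ : ℝ) (x : V) :
    nearPairs δ x = pairCoordinates c ⁻¹'
      {w | |linearGap ((2 / c) • x) w| ≤ 2 / c * δ * ‖w.1‖} := by
  ext z
  simp only [nearPairs, Set.mem_preimage, Set.mem_ofPred_eq, comparisonGap_eq_linearGap hc.ne',
    abs_mul, abs_of_pos (pow_pos hc 2)]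
  have h : 2 * δ * ‖z.1 - z.2‖ = c ^ 2 * (2 / c * δ * ‖(pairCoordinates c z).1‖) := by
    rw [pairCoordinates, norm_smul, norm_inv, Real.norm_of_nonneg hc.le, norm_sub_rev]
    field_simp
  rw [h, mul_le_mul_iff_right₀ (pow_pos hc 2)]

/-- The joint law of a pair of independent centred Gaussian points of covariance `v • 1`. -/
noncomputable def gaussianPairLaw (n : ℕ) (v : ℝ) :
    Measure (EuclideanSpace ℝ (Fin n) × EuclideanSpace ℝ (Fin n)) :=
  (multivariateGaussian 0 (v • (1 : Matrix (Fin n) (Fin n) ℝ))).prod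
    (multivariateGaussian 0 (v • (1 : Matrix (Fin n) (Fin n) ℝ)))

instance (n : ℕ) (v : ℝ) : IsProbabilityMeasure (gaussianPairLaw n v) := by
  unfold gaussianPairLaw
  infer_instance

variable {R : ℝ}

lemma gaussianPairLaw_real_preimage (hn : 1 ≤ n) (hR : 0 < R) {A : Set (V × V)}
    (hA : MeasurableSet A) :
    (gaussianPairLaw n (2 * R ^ 2 / n)).real (pairCoordinates (2 * R / √n) ⁻¹' A) =
      ((stdGaussian V).prod (stdGaussian V)).real A := by
  have hn0 : (0 : ℝ) < n := by exact_mod_cast hn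
  have hc : √(2 * (2 * R ^ 2 / n)) = 2 * R / √n := by
    rw [show 2 * (2 * R ^ 2 / n) = (2 * R) ^ 2 / n by ring, Real.sqrt_div (sq_nonneg _),
      Real.sqrt_sq (by positivity)]
  rw [← map_pairCoordinates (n := n) (v := 2 * R ^ 2 / n) (by positivity), hc,
    map_measureReal_apply (measurable_pairCoordinates _) hA, gaussianPairLaw]

lemma gaussianPairLaw_nearPairs_le (hn : 1 ≤ n) (hR : 0 < R) (x : V) {ζ : ℝ} (hζ : 0 ≤ ζ) :
    (gaussianPairLaw n (2 * R ^ 2 / n)).real (nearPairs (ζ * R / √n) x) ≤ 2 * ζ := by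
  have hn0 : (0 : ℝ) < n := by exact_mod_cast hn
  have hs : 0 < √(n : ℝ) := Real.sqrt_pos.2 hn0
  rw [nearPairs_eq_preimage (c := 2 * R / √n) (by positivity),
    gaussianPairLaw_real_preimage hn hR (measurableSet_abs_linearGap_le _ _),
    show 2 / (2 * R / √n) * (ζ * R / √n) = ζ by field_simp]
  exact stdGaussian_prod_abs_linearGap_le hn _ hζ

lemma gaussianPairLaw_oppositePairs_le (hn : 1 ≤ n) (hR : 0 < R) (x y : V) :
    (gaussianPairLaw n (2 * R ^ 2 / n)).real (oppositePairs x y) ≤ ‖x - y‖ / R := by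
  have hn0 : (0 : ℝ) < n := by exact_mod_cast hn
  have hs : 0 < √(n : ℝ) := Real.sqrt_pos.2 hn0
  rw [oppositePairs_eq_preimage (c := 2 * R / √n) (by positivity),
    gaussianPairLaw_real_preimage hn hR (measurableSet_linearGap_mul_neg _ _)]
  refine (stdGaussian_prod_linearGap_mul_neg_le hn _ _).trans_eq ?_
  rw [← smul_sub, norm_smul, Real.norm_of_nonneg (by positivity)]
  field_simp

lemma le_gaussianPairLaw_oppositePairs (hn : 1 ≤ n) (hR : 0 < R) {x y : V} (hx : ‖x‖ ≤ R)
    (hy : ‖y‖ ≤ R) :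
    separationConstant * (‖x - y‖ / R) ≤
      (gaussianPairLaw n (2 * R ^ 2 / n)).real (oppositePairs x y) := by
  have hn0 : (0 : ℝ) < n := by exact_mod_cast hn
  have hs : 0 < √(n : ℝ) := Real.sqrt_pos.2 hn0
  have hc : ‖2 / (2 * R / √n)‖ = √n / R := by
    rw [Real.norm_of_nonneg (by positivity)]
    field_simp
  -- The rescaling sends the ball of radius `R` into the ball of radius `√n`, as the
  -- standard-coordinate lower bound requires.
  have hscale : ∀ w : V, ‖w‖ ≤ R → ‖(2 / (2 * R / √n)) • w‖ ≤ √n := fun w hw => by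
    rw [norm_smul, hc, div_mul_eq_mul_div, div_le_iff₀ hR]
    gcongr
  rw [oppositePairs_eq_preimage (c := 2 * R / √n) (by positivity),
    gaussianPairLaw_real_preimage hn hR (measurableSet_linearGap_mul_neg _ _)]
  refine le_of_eq_of_le ?_
    (le_stdGaussian_prod_linearGap_mul_neg hn (hscale x hx) (hscale y hy))
  rw [← smul_sub, norm_smul, hc]
  field_simp

end Coordinates

/-! ### The embedding property -/

section Embedding

variable {n m : ℕ}

local notation "V" => EuclideanSpace ℝ (Fin n)

/-- The pairs which separate the `δ`-neighbourhoods of `x` and `y`. -/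
def separatingPairs (δ : ℝ) (x y : V) : Set (V × V) :=
  oppositePairs x y \ (nearPairs δ x ∪ nearPairs δ y)

/-- The pairs which may compare points of the `δ`-neighbourhoods of `x` and `y` differently. -/
def touchingPairs (δ : ℝ) (x y : V) : Set (V × V) :=
  oppositePairs x y ∪ (nearPairs δ x ∪ nearPairs δ y)

lemma measurableSet_separatingPairs (δ : ℝ) (x y : V) : MeasurableSet (separatingPairs δ x y) :=
  (measurableSet_oppositePairs x y).diff
    ((measurableSet_nearPairs δ x).union (measurableSet_nearPairs δ y))

lemma measurableSet_touchingPairs (δ : ℝ) (x y : V) : MeasurableSet (touchingPairs δ x y) :=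
  (measurableSet_oppositePairs x y).union
    ((measurableSet_nearPairs δ x).union (measurableSet_nearPairs δ y))

lemma gaussianPairLaw_nearPairs_union_le {R ζ : ℝ} (hn : 1 ≤ n) (hR : 0 < R) (hζ : 0 ≤ ζ)
    (x y : V) : (gaussianPairLaw n (2 * R ^ 2 / n)).real
      (nearPairs (ζ * R / √n) x ∪ nearPairs (ζ * R / √n) y) ≤ 4 * ζ := by
  have h := measureReal_union_le (μ := gaussianPairLaw n (2 * R ^ 2 / n))
    (nearPairs (ζ * R / √n) x) (nearPairs (ζ * R / √n) y)
  have hx := gaussianPairLaw_nearPairs_le hn hR x hζ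
  have hy := gaussianPairLaw_nearPairs_le hn hR y hζ
  linarith

lemma gaussianPairLaw_touchingPairs_le {R ζ : ℝ} (hn : 1 ≤ n) (hR : 0 < R) (hζ : 0 ≤ ζ)
    (x y : V) : (gaussianPairLaw n (2 * R ^ 2 / n)).real (touchingPairs (ζ * R / √n) x y) ≤
      ‖x - y‖ / R + 4 * ζ :=
  (measureReal_union_le _ _).trans (add_le_add (gaussianPairLaw_oppositePairs_le hn hR x y)
    (gaussianPairLaw_nearPairs_union_le hn hR hζ x y))

lemma le_gaussianPairLaw_separatingPairs {R ζ : ℝ} (hn : 1 ≤ n) (hR : 0 < R) (hζ : 0 ≤ ζ)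
    {x y : V} (hx : ‖x‖ ≤ R) (hy : ‖y‖ ≤ R) : separationConstant * (‖x - y‖ / R) - 4 * ζ ≤
      (gaussianPairLaw n (2 * R ^ 2 / n)).real (separatingPairs (ζ * R / √n) x y) := by
  have h1 := le_gaussianPairLaw_oppositePairs hn hR hx hy
  have h2 := gaussianPairLaw_nearPairs_union_le hn hR hζ x y
  have h3 := le_measureReal_sdiff (μ := gaussianPairLaw n (2 * R ^ 2 / n)) (s₁ := oppositePairs x y)
    (s₂ := nearPairs (ζ * R / √n) x ∪ nearPairs (ζ * R / √n) y)
  rw [separatingPairs]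
  linarith

/-- The frequency of a set among the pairs. -/
noncomputable def pairFrequency (A : Set (V × V)) (p q : Fin m → V) : ℝ :=
  (1 / (m : ℝ)) * ∑ i, A.indicator (fun _ => (1 : ℝ)) (p i, q i)

lemma hammingFraction_le_pairFrequency {s : ℝ} (hs : s ∈ Set.Icc (-1 : ℝ) 1) (p q : Fin m → V)
    {x y x₀ y₀ : V} {δ : ℝ} (hx : ‖x - x₀‖ ≤ δ) (hy : ‖y - y₀‖ ≤ δ) :
    hammingFraction (comparisonPattern s p q x) (comparisonPattern s p q y) ≤
      pairFrequency (touchingPairs δ x₀ y₀) p q :=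
  mul_le_mul_of_nonneg_left (Finset.sum_le_sum fun i _ =>
    half_abs_comparison_sub_le_indicator hs (p i, q i) hx hy) (by positivity)

lemma pairFrequency_le_hammingFraction (s : ℝ) (p q : Fin m → V)
    {x y x₀ y₀ : V} {δ : ℝ} (hx : ‖x - x₀‖ ≤ δ) (hy : ‖y - y₀‖ ≤ δ) :
    pairFrequency (separatingPairs δ x₀ y₀) p q ≤
      hammingFraction (comparisonPattern s p q x) (comparisonPattern s p q y) :=
  mul_le_mul_of_nonneg_left (Finset.sum_le_sum fun i _ =>
    indicator_le_half_abs_comparison_sub (p i, q i) hx hy) (by positivity)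

lemma hammingFraction_nonneg (a b : Fin m → ℝ) : 0 ≤ hammingFraction a b := by
  unfold hammingFraction
  positivity

lemma hammingFraction_comparisonPattern_le_one {s : ℝ} (hs : s ∈ Set.Icc (-1 : ℝ) 1)
    (hm : 1 ≤ m) (p q : Fin m → V) (x y : V) :
    hammingFraction (comparisonPattern s p q x) (comparisonPattern s p q y) ≤ 1 := by
  have hm' : (0 : ℝ) < m := by exact_mod_cast hm
  rw [hammingFraction, one_div, inv_mul_le_iff₀ hm']
  refine (Finset.sum_le_sum fun i _ =>
    half_abs_comparison_sub_le_one hs (p i) (q i) x y).trans_eq ?_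
  simp

lemma abs_norm_sub_sub_norm_sub_le {x y x₀ y₀ : V} {δ : ℝ} (hx : ‖x - x₀‖ ≤ δ)
    (hy : ‖y - y₀‖ ≤ δ) : |‖x - y‖ - ‖x₀ - y₀‖| ≤ 2 * δ := by
  refine (abs_norm_sub_norm_le _ _).trans ?_
  rw [show x - y - (x₀ - y₀) = (x - x₀) - (y - y₀) by abel]
  linarith [norm_sub_le (x - x₀) (y - y₀)]

/-- Outside an event of small probability, all frequencies of separating and touching pairs for
the points of a finite set are close to their probabilities. -/
lemma exists_event_pairFrequency {Ω : Type*} [MeasurableSpace Ω] {μ : Measure Ω}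
    [IsProbabilityMeasure μ] {p q : Fin m → Ω → V} {v : ℝ} (hm : 1 ≤ m)
    (h : IsGaussianPairModel μ v p q) (δ : ℝ) {ζ : ℝ} (hζ : 0 ≤ ζ) (N : Finset V) :
    ∃ E : Set Ω, MeasurableSet E ∧
      1 - (N.card : ℝ) ^ 2 * (2 * Real.exp (-(2 * m * ζ ^ 2))) ≤ μ.real E ∧
      ∀ ω ∈ E, ∀ x ∈ N, ∀ y ∈ N,
        (gaussianPairLaw n v).real (separatingPairs δ x y) - ζ ≤
          pairFrequency (separatingPairs δ x y) (fun i => p i ω) (fun i => q i ω) ∧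
        pairFrequency (touchingPairs δ x y) (fun i => p i ω) (fun i => q i ω) ≤
          (gaussianPairLaw n v).real (touchingPairs δ x y) + ζ := by
  have hW := hasLaw_pair h.hasLaw_fst h.hasLaw_snd h.indep
  have hind := iIndepFun_pair h.hasLaw_fst h.hasLaw_snd h.indep
  -- The bad event of a pair of net points: one lower tail and one upper tail.
  let B : V × V → Set Ω := fun z =>
    {ω | pairFrequency (separatingPairs δ z.1 z.2) (fun i => p i ω) (fun i => q i ω) ≤
      (gaussianPairLaw n v).real (separatingPairs δ z.1 z.2) - ζ} ∪
    {ω | (gaussianPairLaw n v).real (touchingPairs δ z.1 z.2) + ζ ≤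
      pairFrequency (touchingPairs δ z.1 z.2) (fun i => p i ω) (fun i => q i ω)}
  have hB : ∀ z, μ.real (B z) ≤ 2 * Real.exp (-(2 * m * ζ ^ 2)) := fun z => by
    refine (measureReal_union_le _ _).trans ?_
    rw [two_mul (Real.exp _)]
    exact add_le_add
      (measure_frequency_le_le hm hW hind (measurableSet_separatingPairs δ z.1 z.2) hζ)
      (measure_frequency_ge_le hm hW hind (measurableSet_touchingPairs δ z.1 z.2) hζ)
  have hunion : μ.real (⋃ z ∈ N ×ˢ N, B z) ≤
      (N.card : ℝ) ^ 2 * (2 * Real.exp (-(2 * m * ζ ^ 2))) := by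
    refine (measureReal_biUnion_finset_le _ _).trans
      ((Finset.sum_le_sum fun z _ => hB z).trans_eq ?_)
    rw [Finset.sum_const, Finset.card_product, nsmul_eq_mul, Nat.cast_mul, ← pow_two]
  -- The points are only almost everywhere measurable, so the bad set is replaced by a measurable
  -- superset of equal measure.
  refine ⟨(toMeasurable μ (⋃ z ∈ N ×ˢ N, B z))ᶜ, (measurableSet_toMeasurable _ _).compl, ?_, ?_⟩
  · rw [probReal_compl_eq_one_sub (measurableSet_toMeasurable _ _), measureReal_def,
      measure_toMeasurable, ← measureReal_def]
    linarith
  · intro ω hω x hx y hy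
    have hnot : ω ∉ B (x, y) := fun hmem => hω (subset_toMeasurable _ _
      (Set.mem_biUnion (Finset.mem_product.2 ⟨hx, hy⟩ : (x, y) ∈ N ×ˢ N) hmem))
    simp only [B, Set.mem_union, Set.mem_ofPred_eq, not_or, not_le] at hnot
    exact ⟨hnot.1.le, hnot.2.le⟩

/-- Exponentiating the condition on `m` gives `exp(2mζ²) ≥ (3√n/ζ)^(2n) · 2/η`, which absorbs the
`N²` pairs of net points and the two tails of each. -/
lemma sq_mul_two_mul_exp_le {N η ζ : ℝ} (hn : 1 ≤ n) (hη : 0 < η) (hζ : 0 < ζ) (hN0 : 0 ≤ N)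
    (hN : N ≤ (3 * √(n : ℝ) / ζ) ^ n)
    (hm : 1 / (2 * ζ ^ 2) * (2 * (n : ℝ) * Real.log (3 * √(n : ℝ) / ζ) + Real.log (2 / η)) ≤
      (m : ℝ)) :
    N ^ 2 * (2 * Real.exp (-(2 * m * ζ ^ 2))) ≤ η := by
  have hn0 : (0 : ℝ) < n := by exact_mod_cast hn
  have hs : 0 < √(n : ℝ) := Real.sqrt_pos.2 hn0
  have hb : 0 < 3 * √(n : ℝ) / ζ := by positivity
  rw [one_div, inv_mul_le_iff₀ (by positivity)] at hm
  have hexp : Real.exp (2 * (n : ℝ) * Real.log (3 * √(n : ℝ) / ζ) + Real.log (2 / η)) =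
      ((3 * √(n : ℝ) / ζ) ^ n) ^ 2 * (2 / η) := by
    rw [Real.exp_add, Real.exp_log (by positivity), ← pow_mul, mul_comm 2 (n : ℝ),
      mul_comm (_ * _) (Real.log _), show (n : ℝ) * 2 = ((n * 2 : ℕ) : ℝ) by push_cast; ring,
      Real.exp_mul, Real.exp_log hb, Real.rpow_natCast]
  have hle : ((3 * √(n : ℝ) / ζ) ^ n) ^ 2 * (2 / η) ≤ Real.exp (2 * m * ζ ^ 2) := by
    rw [← hexp]
    exact Real.exp_le_exp.2 (hm.trans_eq (by ring))
  have hN2 : N ^ 2 ≤ ((3 * √(n : ℝ) / ζ) ^ n) ^ 2 := pow_le_pow_left₀ hN0 hN 2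
  rw [Real.exp_neg, ← mul_assoc, ← div_eq_mul_inv, div_le_iff₀ (Real.exp_pos _)]
  calc N ^ 2 * 2 ≤ ((3 * √(n : ℝ) / ζ) ^ n) ^ 2 * 2 := by gcongr
    _ = η * (((3 * √(n : ℝ) / ζ) ^ n) ^ 2 * (2 / η)) := by field_simp
    _ ≤ η * Real.exp (2 * m * ζ ^ 2) := by gcongr

end Embedding

theorem mainTheorem2 :
    ∃ C₁ c₁ C₂ c₂ : ℝ, 0 < C₁ ∧ 0 < c₁ ∧ 0 < C₂ ∧ 0 < c₂ ∧
      ∀ (n m : ℕ), 1 ≤ n → 1 ≤ m →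
      ∀ (R η ζ : ℝ), 0 < R → 0 < η → 0 < ζ →
      ∀ (s : ℝ), s ∈ Set.Icc (-1 : ℝ) 1 →
      ∀ (Ω : Type*) [MeasurableSpace Ω] (μ : Measure Ω) [IsProbabilityMeasure μ]
        (p q : Fin m → Ω → EuclideanSpace ℝ (Fin n)),
      IsGaussianPairModel μ (2 * R ^ 2 / (n : ℝ)) p q →
      1 / (2 * ζ ^ 2) * (2 * (n : ℝ) * Real.log (3 * √(n : ℝ) / ζ) + Real.log (2 / η)) ≤ (m : ℝ) →
      ∃ E : Set Ω, MeasurableSet E ∧ 1 - η ≤ μ.real E ∧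
        ∀ ω ∈ E, ∀ x ∈ Metric.closedBall (0 : EuclideanSpace ℝ (Fin n)) R,
          ∀ y ∈ Metric.closedBall (0 : EuclideanSpace ℝ (Fin n)) R,
            C₁ * (‖x - y‖ / R) - c₁ * ζ
                ≤ hammingFraction
                    (comparisonPattern s (fun i => p i ω) (fun i => q i ω) x)
                    (comparisonPattern s (fun i => p i ω) (fun i => q i ω) y) ∧
            hammingFraction
                (comparisonPattern s (fun i => p i ω) (fun i => q i ω) x)
                (comparisonPattern s (fun i => p i ω) (fun i => q i ω) y)
                ≤ C₂ * (‖x - y‖ / R) + c₂ * ζ := by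
  have hC := separationConstant_pos
  -- Near pairs cost `4ζ` and the deviation of frequencies costs `ζ`. Passing to net points changes
  -- `‖x - y‖/R` by at most `2ζ`, which is multiplied by `separationConstant` below and by 1 above.
  refine ⟨separationConstant, 2 * separationConstant + 5, 1, 7, hC, by positivity, one_pos,
    by norm_num, ?_⟩
  intro n m hn hm R η ζ hR hη hζ s hs Ω _ μ _ p q hpq hmle
  have hn1 : (1 : ℝ) ≤ n := by exact_mod_cast hn
  have hsn : 1 ≤ √(n : ℝ) := Real.one_le_sqrt.2 hn1
  simp only [mem_closedBall_zero_iff]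
  -- For `ζ ≥ 1` the lower bound is nonpositive, because `‖x - y‖/R ≤ 2`, and the upper bound
  -- exceeds 1. For `ζ < 1` the net radius satisfies `δ ≤ R`.
  rcases le_or_gt 1 ζ with hζ1 | hζ1
  · refine ⟨Set.univ, MeasurableSet.univ, by simpa using hη.le, fun ω _ x hx y hy => ⟨?_, ?_⟩⟩
    · refine le_trans ?_ (hammingFraction_nonneg _ _)
      have hd : ‖x - y‖ / R ≤ 2 := by
        rw [div_le_iff₀ hR]
        linarith [norm_sub_le x y]
      nlinarith
    · refine (hammingFraction_comparisonPattern_le_one hs hm _ _ x y).trans ?_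
      have : 0 ≤ ‖x - y‖ / R := by positivity
      linarith
  set δ := ζ * R / √(n : ℝ) with hδ
  have hδ0 : 0 < δ := by positivity
  have hδζ : δ / R ≤ ζ := by
    rw [hδ, div_div, div_le_iff₀ (by positivity)]
    nlinarith [mul_le_mul_of_nonneg_left hsn (mul_pos hζ hR).le]
  have hδR : δ ≤ R := by
    rw [div_le_iff₀ hR] at hδζ
    nlinarith
  obtain ⟨N, hNR, hNcard, hNnet⟩ := exists_net_closedBall (n := n) hδ0 hδR
  rw [show 3 * R / δ = 3 * √(n : ℝ) / ζ by rw [hδ]; field_simp] at hNcard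
  obtain ⟨E, hE, hμE, hfreq⟩ := exists_event_pairFrequency hm hpq δ hζ.le N
  have hsmall := sq_mul_two_mul_exp_le hn hη hζ (Nat.cast_nonneg N.card) hNcard hmle
  refine ⟨E, hE, by linarith, fun ω hω x hx y hy => ?_⟩
  obtain ⟨x₀, hx₀, hxx⟩ := hNnet x hx
  obtain ⟨y₀, hy₀, hyy⟩ := hNnet y hy
  obtain ⟨hlow, hupp⟩ := hfreq ω hω x₀ hx₀ y₀ hy₀
  have hsep := le_gaussianPairLaw_separatingPairs hn hR hζ.le (hNR x₀ hx₀) (hNR y₀ hy₀)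
  have htouch := gaussianPairLaw_touchingPairs_le hn hR hζ.le x₀ y₀
  have h1 := pairFrequency_le_hammingFraction s (fun i => p i ω) (fun i => q i ω) hxx hyy
  have h2 := hammingFraction_le_pairFrequency hs (fun i => p i ω) (fun i => q i ω) hxx hyy
  rw [← hδ] at hsep htouch
  have hdist : |‖x - y‖ / R - ‖x₀ - y₀‖ / R| ≤ 2 * ζ := by
    rw [← sub_div, abs_div, abs_of_pos hR]
    refine (div_le_div_of_nonneg_right (abs_norm_sub_sub_norm_sub_le hxx hyy) hR.le).trans ?_
    rw [mul_div_assoc]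
    linarith
  obtain ⟨hd1, hd2⟩ := abs_le.1 hdist
  constructor
  · have := mul_le_mul_of_nonneg_left hd2 hC.le
    linarith
  · linarith
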